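/- Let $G$ be a Polish group (a separable, completely metrisable topological group) that is amenable, i.e. every continuous action of $G$ by affine homeomorphisms on a nonempty compact convex subset of a Hausdorff locally convex topological vector space has a fixed point. Equip $G$ with its left-coarse structure: $E\subseteq G\times G$ is a coarse entourage if and only if $\sup_{(x,y)\in E}d(x,y)<\infty$ for every continuous left-invariant pseudometric $d$ on $G$. Equip a Hilbert space $\mathcal H$ with the coarse structure in which $F\subseteq \mathcal H\times\mathcal H$ is a coarse entourage if and only if $\sup_{(\xi,\zeta)\in F}\|\xi-\zeta\|<\infty$. A map $\sigma\colon G\to\mathcal H$ is a coarse embedding if for every coarse entourage $E$ of $G$ there is a coarse entourage $F$ of $\mathcal H$ such that $(a,b)\in E$ implies $(\sigma(a),\sigma(b))\in F$, and for every coarse entourage $F$ of $\mathcal H$ there is a coarse entourage $E$ of $G$ such that $(a,b)\notin E$ implies $(\sigma(a),\sigma(b))\notin F$. Then the following are equivalent, both when Hilbert spaces are taken over $\mathbb R$ and when they are taken over $\mathbb C$: \begin{enumerate} \item $G$ coarsely embeds into a Hilbert space, i.e. there is a coarse embedding of $G$ into some Hilbert space; \item $G$ has the Haagerup property, i.e.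 there is a continuous action $\alpha$ of $G$ by affine isometries on some Hilbert space $\mathcal H$ that is coarsely proper, meaning that the associated cocycle $b\colon G\to\mathcal H$, $b(g)=\alpha(g)0$, is a coarse embedding. \end{enumerate} -/

import Mathlib

universe u v

/-- A coarse structure on a set, in the sense of Roe. -/
structure CoarseStructure (X : Type u) where
  /-- The coarse entourages. -/
  entourages : Set (Set (X × X))
  diag_mem : {p : X × X | p.1 = p.2} ∈ entourages
  subset_mem : ∀ E F : Set (X × X), F ⊆ E → E ∈ entourages → F ∈ entourages
  inv_mem : ∀ E ∈ entourages, {p : X × X | (p.2, p.1) ∈ E} ∈ entourages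
  union_mem : ∀ E ∈ entourages, ∀ F ∈ entourages, E ∪ F ∈ entourages
  comp_mem : ∀ E ∈ entourages, ∀ F ∈ entourages,
    {p : X × X | ∃ z, (p.1, z) ∈ E ∧ (z, p.2) ∈ F} ∈ entourages

/-- An écart, i.e. a (finite-valued) pseudometric, on a set. -/
structure Ecart (X : Type u) where
  toFun : X → X → ℝ
  self : ∀ x, toFun x x = 0
  symm : ∀ x y, toFun x y = toFun y x
  triangle : ∀ x y z, toFun x z ≤ toFun x y + toFun y z

/-- The coarse structure induced by an écart `d`: a set is an entourage if it is contained in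
`{(x, y) | d x y < r}` for some real `r`. -/
def Ecart.coarse {X : Type u} (d : Ecart X) : CoarseStructure X where
  entourages := {E | ∃ r : ℝ, ∀ p ∈ E, d.toFun p.1 p.2 < r}
  diag_mem := by
    refine ⟨1, fun p hp => ?_⟩
    have hp' : p.1 = p.2 := hp
    rw [hp', d.self]
    exact one_pos
  subset_mem := fun _ _ hFE ⟨r, hr⟩ => ⟨r, fun p hp => hr p (hFE hp)⟩
  inv_mem := fun _ ⟨r, hr⟩ => ⟨r, fun p hp => by rw [d.symm]; exact hr _ hp⟩
  union_mem := by
    rintro E ⟨r, hr⟩ F ⟨s, hs⟩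
    refine ⟨max r s, fun p hp => ?_⟩
    rcases hp with hp | hp
    · exact lt_of_lt_of_le (hr p hp) (le_max_left r s)
    · exact lt_of_lt_of_le (hs p hp) (le_max_right r s)
  comp_mem := by
    rintro E ⟨r, hr⟩ F ⟨s, hs⟩
    refine ⟨r + s, fun p hp => ?_⟩
    obtain ⟨z, h1, h2⟩ := hp
    exact lt_of_le_of_lt (d.triangle p.1 z p.2) (add_lt_add (hr _ h1) (hs _ h2))

/-- The distance of a (pseudo)metric space, as an écart. -/
def metricEcart (X : Type u) [PseudoMetricSpace X] : Ecart X where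
  toFun := dist
  self := dist_self
  symm := dist_comm
  triangle := dist_triangle

/-- A continuous left-invariant écart on a group with a topology. -/
def Ecart.IsContinuousLeftInvariant {G : Type u} [Group G] [TopologicalSpace G]
    (d : Ecart G) : Prop :=
  Continuous (fun p : G × G => d.toFun p.1 p.2) ∧
    ∀ g x y : G, d.toFun (g * x) (g * y) = d.toFun x y

/-- The left-coarse structure of a topological group: the intersection of the coarse structures
induced by all continuous left-invariant écarts. -/
def leftCoarse (G : Type u) [Group G] [TopologicalSpace G] : CoarseStructure G where
  entourages :=
    {E | ∀ d : Ecart G, d.IsContinuousLeftInvariant → E ∈ d.coarse.entourages}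
  diag_mem := fun d _ => d.coarse.diag_mem
  subset_mem := fun E F h hE d hd => d.coarse.subset_mem E F h (hE d hd)
  inv_mem := fun E hE d hd => d.coarse.inv_mem E (hE d hd)
  union_mem := fun E hE F hF d hd => d.coarse.union_mem E (hE d hd) F (hF d hd)
  comp_mem := fun E hE F hF d hd => d.coarse.comp_mem E (hE d hd) F (hF d hd)

/-- A map between coarse spaces is bornologous if it maps entourages into entourages. -/
def IsBornologous {X : Type u} {Y : Type v} (𝓔 : CoarseStructure X) (𝓕 : CoarseStructure Y)
    (σ : X → Y) : Prop :=
  ∀ E ∈ 𝓔.entourages, ∃ F ∈ 𝓕.entourages, ∀ a b : X, (a, b) ∈ E → (σ a, σ b) ∈ F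

/-- A map between coarse spaces is expanding if preimages of entourages are contained in
entourages. -/
def IsExpanding {X : Type u} {Y : Type v} (𝓔 : CoarseStructure X) (𝓕 : CoarseStructure Y)
    (σ : X → Y) : Prop :=
  ∀ F ∈ 𝓕.entourages, ∃ E ∈ 𝓔.entourages, ∀ a b : X, (a, b) ∉ E → (σ a, σ b) ∉ F

/-- A coarse embedding is a bornologous expanding map. -/
def IsCoarseEmbedding {X : Type u} {Y : Type v} (𝓔 : CoarseStructure X)
    (𝓕 : CoarseStructure Y) (σ : X → Y) : Prop :=
  IsBornologous 𝓔 𝓕 σ ∧ IsExpanding 𝓔 𝓕 σ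

/-- Amenability of a topological group: every (jointly) continuous action by affine
homeomorphisms on a nonempty compact convex subset of a (Hausdorff) locally convex topological
vector space has a fixed point. -/
def IsAmenableGroup (G : Type u) [Group G] [TopologicalSpace G] : Prop :=
  ∀ (V : Type u) [AddCommGroup V] [Module ℝ V] [TopologicalSpace V] [IsTopologicalAddGroup V]
    [ContinuousSMul ℝ V] [LocallyConvexSpace ℝ V] [T2Space V]
    (C : Set V) [MulAction G C] [ContinuousSMul G C],
    C.Nonempty → IsCompact C → Convex ℝ C →
    (∀ (g : G) (x y z : C) (s t : ℝ), 0 ≤ s → 0 ≤ t → s + t = 1 →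
      (z : V) = s • (x : V) + t • (y : V) →
      ((g • z : C) : V) = s • ((g • x : C) : V) + t • ((g • y : C) : V)) →
    ∃ x : C, ∀ g : G, g • x = x

/-- The group `G`, with its left-coarse structure, coarsely embeds into a Hilbert space
over `𝕜`. -/
def CoarselyEmbedsIntoHilbert (𝕜 : Type v) [RCLike 𝕜] (G : Type u) [Group G]
    [TopologicalSpace G] : Prop :=
  ∃ (H : Type u) (_ : NormedAddCommGroup H) (_ : InnerProductSpace 𝕜 H) (_ : CompleteSpace H)
    (σ : G → H), IsCoarseEmbedding (leftCoarse G) (metricEcart H).coarse σ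

/-- The Haagerup property: `G` admits a continuous action `α` by affine isometries on a Hilbert
space over `𝕜` that is coarsely proper, i.e. whose cocycle `g ↦ α g 0` is a coarse embedding.
(The linear part of `α` is unitary for `𝕜 = ℂ` and orthogonal for `𝕜 = ℝ`.) -/
def HasHaagerupProperty (𝕜 : Type v) [RCLike 𝕜] (G : Type u) [Group G]
    [TopologicalSpace G] : Prop :=
  ∃ (H : Type u) (_ : NormedAddCommGroup H) (_ : InnerProductSpace 𝕜 H) (_ : CompleteSpace H)
    (α : G →* (H ≃ᵃⁱ[𝕜] H)),
    Continuous (fun p : G × H => α p.1 p.2) ∧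
      IsCoarseEmbedding (leftCoarse G) (metricEcart H).coarse (fun g => α g 0)

/-!
Work throughout with conditionally negative definite kernels, that is, kernels of the form
`‖b x - b y‖ ^ 2` with `b` a map into a real Hilbert space. Let `σ` be a coarse embedding of `G`
into a real Hilbert space. Bornologousness and first countability bound `‖σ x - σ y‖` by `d x y + M`
for some continuous left-invariant écart `d`. By Schoenberg's theorem `‖σ x - σ y‖` is itself
conditionally negative definite; on a maximal `1`-separated set it is at most `(1 + M) d`, so
by a Kirszbraun-type extension theorem for `1/2`-Hölder maps it extends from there to a
conditionally negative definite kernel `K ≤ (1 + M) d` on all of `G`, and still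
`‖σ x - σ y‖ ≤ 2 K x y + 10 (1 + M)`.

The conditionally negative definite kernels between a left-invariant lower bound and the continuous
left-invariant bound `(1 + M) d` form a compact convex set, and the upper bound makes the action of
`G` on it jointly continuous, even though the kernels are not assumed continuous. Amenability gives
an invariant kernel in this set, which is the squared displacement of the cocycle of a continuous
affine isometric action; the lower bound makes that action coarsely proper.
-/

open Filter MeasureTheory Set Topology
open scoped InnerProductSpace Matrix

section PosSemidef

variable {X : Type u}

theorem gram_posSemidef {E : Type*} [SeminormedAddCommGroup E] [InnerProductSpace ℝ E]
    (p : X → E) : (Matrix.gram ℝ p).PosSemidef := by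
  refine ⟨Matrix.isHermitian_gram ℝ p, fun c => ?_⟩
  have hc : ⟪∑ x ∈ c.support, c x • p x, ∑ x ∈ c.support, c x • p x⟫_ℝ =
      c.sum fun x a => c.sum fun y b => star a * Matrix.gram ℝ p x y * b := by
    simp only [sum_inner, inner_sum, real_inner_smul_left, real_inner_smul_right,
      Matrix.gram_apply, Finsupp.sum, star_trivial]
    exact Finset.sum_comm.trans (Finset.sum_congr rfl fun x _ => Finset.sum_congr rfl fun y _ =>
      by rw [real_inner_comm]; ring)
  exact hc ▸ real_inner_self_nonneg

theorem isClosed_setOf_posSemidef : IsClosed {M : Matrix X X ℝ | M.PosSemidef} := by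
  simp only [Matrix.PosSemidef, Matrix.IsHermitian, ofPred_and, ofPred_forall]
  refine (isClosed_eq (by fun_prop) continuous_id).inter
    (isClosed_iInter fun c => isClosed_le continuous_const ?_)
  simp only [Finsupp.sum]
  fun_prop

theorem integral_posSemidef {Ω : Type*} [MeasurableSpace Ω] {μ : Measure Ω}
    {M : Ω → Matrix X X ℝ} (hM : ∀ ω, (M ω).PosSemidef)
    (hint : ∀ x y, Integrable (fun ω => M ω x y) μ) :
    (Matrix.of fun x y => ∫ ω, M ω x y ∂μ).PosSemidef := by
  refine ⟨Matrix.IsHermitian.ext fun x y => ?_, fun c => ?_⟩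
  · exact integral_congr_ae (ae_of_all μ fun ω => (hM ω).isHermitian.apply x y)
  · calc 0 ≤ ∫ ω, c.sum fun x a => c.sum fun y b => star a * M ω x y * b ∂μ :=
          integral_nonneg fun ω => (hM ω).2 c
      _ = _ := by
          simp only [Finsupp.sum, Matrix.of_apply]
          rw [integral_finsetSum _ fun x _ => integrable_finsetSum _ fun y _ =>
            ((hint x y).const_mul _).mul_const _]
          refine Finset.sum_congr rfl fun x _ => ?_
          rw [integral_finsetSum _ fun y _ => ((hint x y).const_mul _).mul_const _]
          simp only [integral_const_mul, integral_mul_const]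

theorem map_pow_posSemidef {M : Matrix X X ℝ} (hM : M.PosSemidef) (n : ℕ) :
    (M.map (· ^ n)).PosSemidef := by
  induction n with
  | zero =>
    have hone : M.map (· ^ 0) = Matrix.gram ℝ fun _ : X => (1 : ℝ) := by
      ext; simp [Matrix.gram_apply]
    exact hone ▸ gram_posSemidef _
  | succ n ih =>
    have hsucc : M.map (· ^ (n + 1)) = M.map (· ^ n) ⊙ M := by
      ext; simp [pow_succ]
    exact hsucc ▸ ih.hadamard hM

theorem map_exp_posSemidef {M : Matrix X X ℝ} (hM : M.PosSemidef) :
    (M.map Real.exp).PosSemidef := by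
  let S : ℕ → Matrix X X ℝ := fun N =>
    ∑ n ∈ Finset.range N, (n.factorial : ℝ)⁻¹ • M.map (· ^ n)
  have hS : ∀ N, (S N).PosSemidef := fun N =>
    Matrix.posSemidef_sum _ fun n _ => (map_pow_posSemidef hM n).smul (by positivity)
  have htendsto : Tendsto S atTop (𝓝 (M.map Real.exp)) := by
    refine tendsto_pi_nhds.2 fun x => tendsto_pi_nhds.2 fun y => ?_
    simpa only [S, Matrix.sum_apply, Matrix.smul_apply, Matrix.map_apply, smul_eq_mul,
      Real.exp_eq_exp_ℝ] using
      (NormedSpace.exp_series_hasSum_exp' (𝕂 := ℝ) (M x y)).tendsto_sum_nat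
  exact isClosed_setOf_posSemidef.mem_of_tendsto htendsto (Eventually.of_forall hS)

theorem exists_inner_eq_of_posSemidef {M : Matrix X X ℝ} (hM : M.PosSemidef) :
    ∃ (H : Type u) (_ : NormedAddCommGroup H) (_ : InnerProductSpace ℝ H) (_ : CompleteSpace H)
      (b : X → H), (∀ x y, ⟪b x, b y⟫_ℝ = M x y) ∧
        Dense (Submodule.span ℝ (range b) : Set H) := by
  let K : Matrix X X (ℝ →L[ℝ] ℝ) := Matrix.of fun x y => M x y • 1
  have hsymm : ∀ x y, M y x = M x y := fun x y => hM.isHermitian.apply x y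
  have hK : K.PosSemidef := by
    refine ((RKHS.posSemidef_tfae (K := K)).out 0 2 rfl rfl).2
      ⟨Matrix.IsHermitian.ext fun x y => ?_, fun c => ?_⟩
    · simp [K, hsymm x y]
    · have hc : (c.sum fun x a => c.sum fun y b => ⟪K y x a, b⟫_ℝ) =
          c.sum fun x a => c.sum fun y b => star a * M x y * b :=
        Finset.sum_congr rfl fun x _ => Finset.sum_congr rfl fun y _ => by
          simp [K, hsymm x y, mul_comm]
      exact (hM.2 c).trans_eq (congrArg RCLike.re hc).symm
  have : Fact K.PosSemidef := ⟨hK⟩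
  refine ⟨RKHS.OfKernel K, inferInstance, inferInstance, inferInstance,
    fun x => RKHS.kerFun (RKHS.OfKernel K) x 1, fun x y => ?_, ?_⟩
  · rw [← RKHS.kernel_inner, RKHS.OfKernel.kernel_ofKernel]
    simp [K, hsymm]
  · have hspan : {RKHS.kerFun (RKHS.OfKernel K) x v | (x : X) (v : ℝ)} ⊆
        Submodule.span ℝ (range fun x => RKHS.kerFun (RKHS.OfKernel K) x (1 : ℝ)) := by
      rintro _ ⟨x, v, rfl⟩
      rw [show v = v • (1 : ℝ) by simp, map_smul]
      exact Submodule.smul_mem _ _ (Submodule.subset_span ⟨x, rfl⟩)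
    have hdense := RKHS.kerFun_dense (𝕜 := ℝ) (V := ℝ) (RKHS.OfKernel K)
    exact (Submodule.dense_iff_topologicalClosure_eq_top.2 hdense).mono
      (Submodule.span_le.2 hspan)

end PosSemidef

section IsCondNegDef

variable {X : Type u} {E : Type*} [SeminormedAddCommGroup E] [InnerProductSpace ℝ E]

/-- Conditionally negative definite kernels, normalised to vanish on the diagonal. Instead of
requiring `∑ c i * c j * K (x i) (x j) ≤ 0` for all coefficients with sum `0`, we use the
equivalent condition of Schoenberg that each kernel `K x o + K o y - K x y` is positive
semidefinite. -/
structure IsCondNegDef (K : X → X → ℝ) : Prop where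
  self : ∀ x, K x x = 0
  symm : ∀ x y, K x y = K y x
  posSemidef : ∀ o, (Matrix.of fun x y => K x o + K o y - K x y).PosSemidef

theorem isCondNegDef_norm_sub_sq (p : X → E) : IsCondNegDef fun x y => ‖p x - p y‖ ^ 2 where
  self x := by simp
  symm x y := by rw [norm_sub_rev]
  posSemidef o := by
    have hgram : (Matrix.of fun x y => ‖p x - p o‖ ^ 2 + ‖p o - p y‖ ^ 2 - ‖p x - p y‖ ^ 2) =
        (2 : ℝ) • Matrix.gram ℝ fun x => p x - p o := by
      ext x y
      have h := norm_sub_sq_real (p x - p o) (p y - p o)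
      rw [sub_sub_sub_cancel_right] at h
      simp only [Matrix.of_apply, Matrix.smul_apply, Matrix.gram_apply, smul_eq_mul, h,
        norm_sub_rev (p o)]
      ring
    exact hgram ▸ (gram_posSemidef _).smul zero_le_two

namespace IsCondNegDef

variable {K L : X → X → ℝ}

theorem comp {Y : Type*} (hK : IsCondNegDef K) (f : Y → X) :
    IsCondNegDef fun x y => K (f x) (f y) where
  self x := hK.self (f x)
  symm x y := hK.symm (f x) (f y)
  posSemidef o := (hK.posSemidef (f o)).submatrix f

theorem add (hK : IsCondNegDef K) (hL : IsCondNegDef L) : IsCondNegDef (K + L) where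
  self x := by simp [hK.self, hL.self]
  symm x y := by simp [hK.symm x y, hL.symm x y]
  posSemidef o := by
    convert! (hK.posSemidef o).add (hL.posSemidef o) using 1
    ext
    simp only [Matrix.of_apply, Matrix.add_apply, Pi.add_apply]
    ring

theorem smul (hK : IsCondNegDef K) {c : ℝ} (hc : 0 ≤ c) : IsCondNegDef (c • K) where
  self x := by simp [hK.self]
  symm x y := by simp [hK.symm x y]
  posSemidef o := by
    convert! (hK.posSemidef o).smul hc using 1
    ext
    simp only [Matrix.of_apply, Matrix.smul_apply, Pi.smul_apply, smul_eq_mul]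
    ring

theorem integral {Ω : Type*} [MeasurableSpace Ω] {μ : Measure Ω} {K : Ω → X → X → ℝ}
    (hK : ∀ ω, IsCondNegDef (K ω)) (hint : ∀ x y, Integrable (fun ω => K ω x y) μ) :
    IsCondNegDef fun x y => ∫ ω, K ω x y ∂μ where
  self x := by simp [(hK _).self]
  symm x y := by simp only [(hK _).symm x y]
  posSemidef o := by
    convert! integral_posSemidef (fun ω => (hK ω).posSemidef o)
      (fun x y => ((hint x o).add (hint o y)).sub (hint x y)) using 1
    ext x y
    simp only [Matrix.of_apply]
    rw [← integral_add (hint x o) (hint o y)]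
    exact (integral_sub ((hint x o).add (hint o y)) (hint x y)).symm

theorem nonneg (hK : IsCondNegDef K) (x y : X) : 0 ≤ K x y := by
  have h := (hK.posSemidef y).diag_nonneg (i := x)
  rw [Matrix.of_apply, hK.self, hK.symm y x] at h
  linarith

theorem exists_norm_sub_sq_eq (hK : IsCondNegDef K) (o : X) :
    ∃ (H : Type u) (_ : NormedAddCommGroup H) (_ : InnerProductSpace ℝ H) (_ : CompleteSpace H)
      (b : X → H), (∀ x y, ‖b x - b y‖ ^ 2 = K x y) ∧ b o = 0 ∧
        Dense (Submodule.span ℝ (range b) : Set H) := by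
  obtain ⟨H, _, _, _, b, hb, hdense⟩ := exists_inner_eq_of_posSemidef
    ((hK.posSemidef o).smul (a := (1 / 2 : ℝ)) (by norm_num))
  simp only [Matrix.smul_apply, Matrix.of_apply, smul_eq_mul] at hb
  refine ⟨H, _, _, inferInstance, b, fun x y => ?_, ?_, hdense⟩
  · rw [norm_sub_sq_real, ← real_inner_self_eq_norm_sq, ← real_inner_self_eq_norm_sq, hb, hb, hb,
      hK.self, hK.self, hK.symm o x, hK.symm o y]
    ring
  · rw [← inner_self_eq_zero (𝕜 := ℝ), hb, hK.self]
    ring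

theorem abs_sqrt_sub_sqrt_le (hK : IsCondNegDef K) (x y x' y' : X) :
    |√(K x y) - √(K x' y')| ≤ √(K x x') + √(K y y') := by
  obtain ⟨H, _, _, _, b, hb, -⟩ := hK.exists_norm_sub_sq_eq x
  have hdist : ∀ x y, √(K x y) = dist (b x) (b y) := fun x y => by
    rw [← hb, Real.sqrt_sq (norm_nonneg _), dist_eq_norm]
  simpa only [hdist, Real.dist_eq] using dist_dist_dist_le (b x) (b y) (b x') (b y')

end IsCondNegDef

theorem isClosed_setOf_isCondNegDef : IsClosed {K : X → X → ℝ | IsCondNegDef K} := by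
  have hset : {K : X → X → ℝ | IsCondNegDef K} =
      {K | ∀ x, K x x = 0} ∩ {K | ∀ x y, K x y = K y x} ∩
      {K | ∀ o, (Matrix.of fun x y => K x o + K o y - K x y).PosSemidef} := by
    ext K
    exact ⟨fun h => ⟨⟨h.self, h.symm⟩, h.posSemidef⟩, fun h => ⟨h.1.1, h.1.2, h.2⟩⟩
  simp only [hset, ofPred_forall]
  refine ((isClosed_iInter fun x => isClosed_eq (by fun_prop) (by fun_prop)).inter
    (isClosed_iInter fun x => isClosed_iInter fun y =>
      isClosed_eq (by fun_prop) (by fun_prop))).inter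
    (isClosed_iInter fun o => isClosed_setOf_posSemidef.preimage ?_)
  exact continuous_pi fun x => continuous_pi fun y => by simp only [Matrix.of_apply]; fun_prop

theorem convex_setOf_isCondNegDef : Convex ℝ {K : X → X → ℝ | IsCondNegDef K} :=
  fun _ hK _ hL _ _ hs ht _ => (hK.smul hs).add (hL.smul ht)

theorem isCondNegDef_of_posSemidef {M : Matrix X X ℝ} (hM : M.PosSemidef) :
    IsCondNegDef fun x y => M x x + M y y - 2 * M x y := by
  obtain ⟨H, _, _, _, b, hb, -⟩ := exists_inner_eq_of_posSemidef hM
  have hnorm : (fun x y => M x x + M y y - 2 * M x y) = fun x y => ‖b x - b y‖ ^ 2 := by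
    ext x y
    rw [norm_sub_sq_real, ← real_inner_self_eq_norm_sq, ← real_inner_self_eq_norm_sq, hb, hb, hb]
    ring
  exact hnorm ▸ isCondNegDef_norm_sub_sq b

theorem gaussian_posSemidef (p : X → E) :
    (Matrix.of fun x y => Real.exp (-‖p x - p y‖ ^ 2)).PosSemidef := by
  have hfactor : (Matrix.of fun x y => Real.exp (-‖p x - p y‖ ^ 2)) =
      Matrix.gram ℝ (fun x => Real.exp (-‖p x‖ ^ 2)) ⊙
        ((2 : ℝ) • Matrix.gram ℝ p).map Real.exp := by
    ext x y
    simp only [Matrix.of_apply, Matrix.hadamard_apply, Matrix.map_apply, Matrix.smul_apply,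
      Matrix.gram_apply, RCLike.inner_apply, smul_eq_mul, conj_trivial, ← Real.exp_add,
      norm_sub_sq_real]
    ring_nf
  exact hfactor ▸ (gram_posSemidef _).hadamard
    (map_exp_posSemidef ((gram_posSemidef p).smul zero_le_two))

theorem isCondNegDef_one_sub_gaussian (p : X → E) :
    IsCondNegDef fun x y => 1 - Real.exp (-‖p x - p y‖ ^ 2) := by
  convert! (isCondNegDef_of_posSemidef (gaussian_posSemidef p)).smul (c := 1 / 2) (by norm_num)
    using 1
  ext x y
  simp only [Matrix.of_apply, Pi.smul_apply, smul_eq_mul, sub_self, norm_zero,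
    zero_pow two_ne_zero, neg_zero, Real.exp_zero]
  ring

theorem integrable_one_sub_gaussian_div_sq (r : ℝ) :
    Integrable fun t : ℝ => (1 - Real.exp (-(t * r) ^ 2)) / t ^ 2 := by
  have hmeas : Measurable fun t : ℝ => (1 - Real.exp (-(t * r) ^ 2)) / t ^ 2 := by fun_prop
  refine (integrable_inv_one_add_sq.const_mul (1 + r ^ 2)).mono' hmeas.aestronglyMeasurable
    (ae_of_all _ fun t => ?_)
  have hle_one : Real.exp (-(t * r) ^ 2) ≤ 1 := Real.exp_le_one_iff.2 (by simp [sq_nonneg])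
  rw [Real.norm_of_nonneg (div_nonneg (sub_nonneg.2 hle_one) (sq_nonneg t)), ← div_eq_mul_inv]
  rcases eq_or_ne t 0 with rfl | ht
  · simp only [zero_pow two_ne_zero, div_zero]
    positivity
  · rw [div_le_div_iff₀ (by positivity) (by positivity)]
    nlinarith [Real.add_one_le_exp (-(t * r) ^ 2), Real.exp_pos (-(t * r) ^ 2), sq_nonneg t]

theorem integral_one_sub_gaussian_div_sq (r : ℝ) :
    ∫ t : ℝ, (1 - Real.exp (-(t * r) ^ 2)) / t ^ 2 =
      (∫ t : ℝ, (1 - Real.exp (-t ^ 2)) / t ^ 2) * |r| := by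
  rcases eq_or_ne r 0 with rfl | hr
  · simp
  have hscale : ∀ t : ℝ, (1 - Real.exp (-(t * r) ^ 2)) / t ^ 2 =
      r ^ 2 * ((1 - Real.exp (-(t * r) ^ 2)) / (t * r) ^ 2) := fun t => by
    rw [mul_pow t r]
    field_simp
  simp only [hscale]
  rw [integral_const_mul,
    Measure.integral_comp_mul_right (fun t => (1 - Real.exp (-t ^ 2)) / t ^ 2) r, abs_inv,
    smul_eq_mul, ← sq_abs r]
  field_simp

theorem integral_one_sub_gaussian_div_sq_pos :
    0 < ∫ t : ℝ, (1 - Real.exp (-t ^ 2)) / t ^ 2 := by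
  have hnonneg : 0 ≤ fun t : ℝ => (1 - Real.exp (-t ^ 2)) / t ^ 2 := fun t =>
    div_nonneg (sub_nonneg.2 (Real.exp_le_one_iff.2 (by simp [sq_nonneg]))) (sq_nonneg t)
  rw [integral_pos_iff_support_of_nonneg hnonneg
    (by simpa using integrable_one_sub_gaussian_div_sq 1)]
  have hsupport : Ioo (0 : ℝ) 1 ⊆ Function.support fun t : ℝ => (1 - Real.exp (-t ^ 2)) / t ^ 2 :=
    fun t ht => (div_pos (sub_pos.2 (Real.exp_lt_one_iff.2 (by simp [pow_pos ht.1])))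
      (pow_pos ht.1 2)).ne'
  exact (by simp : 0 < volume (Ioo (0 : ℝ) 1)).trans_le (measure_mono hsupport)

theorem isCondNegDef_norm_sub (p : X → E) : IsCondNegDef fun x y => ‖p x - p y‖ := by
  have hgaussian : ∀ t : ℝ,
      IsCondNegDef fun x y => (1 - Real.exp (-(t * ‖p x - p y‖) ^ 2)) / t ^ 2 := fun t => by
    convert! (isCondNegDef_one_sub_gaussian fun x => t • p x).smul (c := (t ^ 2)⁻¹) (by positivity)
      using 1
    ext x y
    simp only [Pi.smul_apply, smul_eq_mul, ← smul_sub, norm_smul, Real.norm_eq_abs, mul_pow, sq_abs]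
    ring
  convert! (IsCondNegDef.integral hgaussian fun x y =>
    integrable_one_sub_gaussian_div_sq ‖p x - p y‖).smul
      (inv_nonneg.2 integral_one_sub_gaussian_div_sq_pos.le) using 1
  ext x y
  simp only [Pi.smul_apply, smul_eq_mul, integral_one_sub_gaussian_div_sq, abs_norm,
    inv_mul_cancel_left₀ integral_one_sub_gaussian_div_sq_pos.ne']

end IsCondNegDef

section HolderExtension

variable {E ι : Type*} [NormedAddCommGroup E] [InnerProductSpace ℝ E] [Fintype ι]

theorem sum_mul_norm_sub_sq {c : ι → ℝ} (hc : ∑ i, c i = 1) (y : ι → E) (w : E) :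
    ∑ i, c i * ‖y i - w‖ ^ 2 =
      ∑ i, c i * ‖y i - ∑ j, c j • y j‖ ^ 2 + ‖(∑ j, c j • y j) - w‖ ^ 2 := by
  set z := ∑ j, c j • y j with hz
  have hcentered : ∑ i, c i * ⟪y i - z, z - w⟫_ℝ = 0 := by
    simp only [← real_inner_smul_left, ← sum_inner, smul_sub, Finset.sum_sub_distrib,
      ← Finset.sum_smul, hc, one_smul, ← hz, sub_self, inner_zero_left]
  have hexpand : ∀ i, c i * ‖y i - w‖ ^ 2 =
      c i * ‖y i - z‖ ^ 2 + 2 * (c i * ⟪y i - z, z - w⟫_ℝ) + c i * ‖z - w‖ ^ 2 := fun i => by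
    rw [← sub_add_sub_cancel (y i) z w, norm_add_sq_real]
    ring
  simp only [hexpand, Finset.sum_add_distrib, ← Finset.mul_sum, ← Finset.sum_mul, hcentered, hc]
  ring

theorem sum_sum_mul_norm_sub_sq {c : ι → ℝ} (hc : ∑ i, c i = 1) (y : ι → E) :
    ∑ i, ∑ j, c i * c j * ‖y i - y j‖ ^ 2 =
      2 * ∑ i, c i * ‖y i - ∑ j, c j • y j‖ ^ 2 := by
  set z := ∑ j, c j • y j with hz
  calc ∑ i, ∑ j, c i * c j * ‖y i - y j‖ ^ 2 = ∑ i, c i * ∑ j, c j * ‖y j - y i‖ ^ 2 := by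
        simp only [Finset.mul_sum, mul_assoc, fun i j => norm_sub_rev (y i) (y j)]
    _ = ∑ i, c i * (∑ j, c j * ‖y j - z‖ ^ 2 + ‖y i - z‖ ^ 2) := by
        simp only [sum_mul_norm_sub_sq hc y (y _), ← hz, norm_sub_rev z]
    _ = 2 * ∑ i, c i * ‖y i - z‖ ^ 2 := by
        rw [two_mul]
        simp only [mul_add, Finset.sum_add_distrib, ← Finset.sum_mul, hc, one_mul]

/-- The dual objective of the problem of finding `z` with `‖y i - z‖ ^ 2 ≤ r i` for all `i`:
by the variance identity it is the minimum over `z` of the Lagrangian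
`∑ i, c i * (‖y i - z‖ ^ 2 - r i)`, attained at the barycentre of the points `y i`. -/
noncomputable def ballsDual (y : ι → E) (r c : ι → ℝ) : ℝ :=
  ∑ i, c i * (‖y i - ∑ j, c j • y j‖ ^ 2 - r i)

theorem continuous_ballsDual (y : ι → E) (r : ι → ℝ) : Continuous (ballsDual y r) := by
  unfold ballsDual
  fun_prop

theorem ballsDual_nonpos {y : ι → E} {r c : ι → ℝ} (hyr : ∀ i j, ‖y i - y j‖ ^ 2 ≤ r i + r j)
    (hc : c ∈ stdSimplex ℝ ι) : ballsDual y r c ≤ 0 := by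
  have hdouble : ∑ i, ∑ j, c i * c j * ‖y i - y j‖ ^ 2 ≤ 2 * ∑ i, c i * r i :=
    calc ∑ i, ∑ j, c i * c j * ‖y i - y j‖ ^ 2 ≤ ∑ i, ∑ j, c i * c j * (r i + r j) := by
          gcongr with i _ j _
          · exact mul_nonneg (hc.1 i) (hc.1 j)
          · exact hyr i j
      _ = 2 * ∑ i, c i * r i := by
          simp only [mul_add, Finset.sum_add_distrib, mul_assoc, ← Finset.mul_sum, ← Finset.sum_mul,
            hc.2, one_mul, two_mul]
  rw [sum_sum_mul_norm_sub_sq hc.2] at hdouble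
  simp only [ballsDual, mul_sub, Finset.sum_sub_distrib]
  linarith

theorem ballsDual_lineMap_single [DecidableEq ι] {c : ι → ℝ} (hc : ∑ i, c i = 1) (y : ι → E)
    (r : ι → ℝ) (i : ι) (t : ℝ) :
    ballsDual y r (AffineMap.lineMap c (Pi.single i 1) t) =
      (1 - t) * ballsDual y r c + t * ((1 - t) * ‖y i - ∑ j, c j • y j‖ ^ 2 - r i) := by
  set z := ∑ j, c j • y j with hz
  have hbary : ∑ j, AffineMap.lineMap c (Pi.single i (1 : ℝ)) t j • y j = z + t • (y i - z) := by
    simp [AffineMap.lineMap_apply_module, add_smul, Finset.sum_add_distrib, mul_smul,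
      ← Finset.smul_sum, ← hz, Pi.single_apply, ite_smul]
    module
  have hsum : ∀ h : ι → ℝ, ∑ j, AffineMap.lineMap c (Pi.single i (1 : ℝ)) t j * h j =
      (1 - t) * ∑ j, c j * h j + t * h i := fun h => by
    simp [AffineMap.lineMap_apply_module, add_mul, Finset.sum_add_distrib, mul_assoc,
      ← Finset.mul_sum, Pi.single_apply]
  have hshift : ∑ j, c j * (‖y j - (z + t • (y i - z))‖ ^ 2 - r j) =
      ballsDual y r c + t ^ 2 * ‖y i - z‖ ^ 2 := by
    simp only [ballsDual, mul_sub, Finset.sum_sub_distrib, ← hz]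
    rw [sum_mul_norm_sub_sq hc, ← hz, sub_add_cancel_left, norm_neg, norm_smul, mul_pow,
      Real.norm_eq_abs, sq_abs]
    ring
  have hvertex : ‖y i - (z + t • (y i - z))‖ ^ 2 = (1 - t) ^ 2 * ‖y i - z‖ ^ 2 := by
    rw [show y i - (z + t • (y i - z)) = (1 - t) • (y i - z) by module, norm_smul, mul_pow,
      Real.norm_eq_abs, sq_abs]
  rw [ballsDual, hbary, hsum, hshift, hvertex]
  ring

theorem exists_forall_norm_sub_sq_le {ι : Type*} [Finite ι] {y : ι → E} {r : ι → ℝ}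
    (hyr : ∀ i j, ‖y i - y j‖ ^ 2 ≤ r i + r j) : ∃ z, ∀ i, ‖y i - z‖ ^ 2 ≤ r i := by
  classical
  cases nonempty_fintype ι
  cases isEmpty_or_nonempty ι
  · exact ⟨0, isEmptyElim⟩
  obtain ⟨c, hc, hmax⟩ := (isCompact_stdSimplex (𝕜 := ℝ) ι).exists_isMaxOn
    (nonempty_coe_sort.1 inferInstance) (continuous_ballsDual y r).continuousOn
  refine ⟨∑ j, c j • y j, fun i => ?_⟩
  have hfirst_order : ∀ᶠ t in 𝓝[>] (0 : ℝ),
      (1 - t) * ‖y i - ∑ j, c j • y j‖ ^ 2 - r i ≤ ballsDual y r c := by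
    filter_upwards [Ioo_mem_nhdsGT zero_lt_one] with t ht
    have hle := hmax ((convex_stdSimplex ℝ ι).lineMap_mem hc (single_mem_stdSimplex ℝ i)
      ⟨ht.1.le, ht.2.le⟩)
    rw [mem_ofPred_eq, ballsDual_lineMap_single hc.2] at hle
    exact le_of_mul_le_mul_left (by linarith) ht.1
  have hlim : Tendsto (fun t : ℝ => (1 - t) * ‖y i - ∑ j, c j • y j‖ ^ 2 - r i) (𝓝[>] 0)
      (𝓝 ((1 - 0) * ‖y i - ∑ j, c j • y j‖ ^ 2 - r i)) :=
    (Continuous.tendsto (by fun_prop) 0).mono_left nhdsWithin_le_nhds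
  linarith [le_of_tendsto hlim hfirst_order, ballsDual_nonpos hyr hc]

theorem Ecart.exists_holder_extension_insert {X : Type u} [DecidableEq X] (d : Ecart X) {p : X → E}
    {s : Finset X} (hp : ∀ x ∈ s, ∀ y ∈ s, ‖p x - p y‖ ^ 2 ≤ d.toFun x y) (a : X) :
    ∃ q : X → E, EqOn q p s ∧
      ∀ x ∈ insert a s, ∀ y ∈ insert a s, ‖q x - q y‖ ^ 2 ≤ d.toFun x y := by
  by_cases ha : a ∈ s
  · exact ⟨p, eqOn_refl p s, by rwa [Finset.insert_eq_of_mem ha]⟩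
  obtain ⟨z, hz⟩ := exists_forall_norm_sub_sq_le (y := fun x : s => p x)
    (r := fun x => d.toFun x a) fun x y => (hp x x.2 y y.2).trans <|
      (d.triangle x a y).trans_eq (by rw [d.symm a])
  have hq : EqOn (Function.update p a z) p s := fun x hx =>
    Function.update_of_ne (ne_of_mem_of_not_mem hx ha) z p
  refine ⟨Function.update p a z, hq, fun x hx y hy => ?_⟩
  rcases Finset.mem_insert.1 hx with rfl | hxs <;> rcases Finset.mem_insert.1 hy with rfl | hys
  · simp [d.self]
  · rw [Function.update_self, hq hys, norm_sub_rev, d.symm]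
    exact hz ⟨y, hys⟩
  · rw [Function.update_self, hq hxs]
    exact hz ⟨x, hxs⟩
  · rw [hq hxs, hq hys]
    exact hp x hxs y hys

theorem Ecart.exists_holder_extension_union {X : Type u} [DecidableEq X] (d : Ecart X) {p : X → E}
    {t : Finset X} (hp : ∀ x ∈ t, ∀ y ∈ t, ‖p x - p y‖ ^ 2 ≤ d.toFun x y) (s : Finset X) :
    ∃ q : X → E, EqOn q p t ∧ ∀ x ∈ s ∪ t, ∀ y ∈ s ∪ t, ‖q x - q y‖ ^ 2 ≤ d.toFun x y := by
  induction s using Finset.induction_on with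
  | empty => exact ⟨p, eqOn_refl p t, by rwa [Finset.empty_union]⟩
  | insert a s _ ih =>
    obtain ⟨q, hqp, hq⟩ := ih
    obtain ⟨q', hq'q, hq'⟩ := d.exists_holder_extension_insert hq a
    refine ⟨q', fun x hx => (hq'q (Finset.mem_union_right s hx)).trans (hqp hx), ?_⟩
    rwa [Finset.insert_union]

theorem Ecart.exists_isCondNegDef_extension {X : Type u} (d : Ecart X) {N : Set X} {p : X → E}
    (hp : ∀ x ∈ N, ∀ y ∈ N, ‖p x - p y‖ ^ 2 ≤ d.toFun x y) :
    ∃ K : X → X → ℝ, IsCondNegDef K ∧ K ≤ d.toFun ∧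
      ∀ x ∈ N, ∀ y ∈ N, K x y = ‖p x - p y‖ ^ 2 := by
  classical
  have hfinite : ∀ s : Finset X, ∃ q : X → E, (∀ x ∈ s, x ∈ N → q x = p x) ∧
      ∀ x ∈ s, ∀ y ∈ s, ‖q x - q y‖ ^ 2 ≤ d.toFun x y := fun s => by
    obtain ⟨q, hqp, hq⟩ := d.exists_holder_extension_union (t := s.filter (· ∈ N))
      (fun x hx y hy => hp x (Finset.mem_filter.1 hx).2 y (Finset.mem_filter.1 hy).2) s
    exact ⟨q, fun x hx hxN => hqp (Finset.mem_filter.2 ⟨hx, hxN⟩), fun x hx y hy =>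
      hq x (Finset.mem_union_left _ hx) y (Finset.mem_union_left _ hy)⟩
  choose q hqp hqd using hfinite
  let U : Ultrafilter (Finset X) := .of atTop
  have hmem : ∀ x, ∀ᶠ s in (U : Filter (Finset X)), x ∈ s := fun x =>
    Ultrafilter.of_le atTop <| (eventually_ge_atTop {x}).mono fun _ => Finset.singleton_subset_iff.1
  have hlim : ∀ x y, ∃ k ≤ d.toFun x y, Tendsto (fun s => ‖q s x - q s y‖ ^ 2) U (𝓝 k) := by
    intro x y
    have hIcc : ∀ᶠ s in (U : Filter (Finset X)), ‖q s x - q s y‖ ^ 2 ∈ Icc 0 (d.toFun x y) := by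
      filter_upwards [hmem x, hmem y] with s hx hy using ⟨sq_nonneg _, hqd s x hx y hy⟩
    obtain ⟨k, hk, hlim⟩ := isCompact_Icc.ultrafilter_le_nhds' (U.map _) hIcc
    exact ⟨k, hk.2, hlim⟩
  choose K hKd hK using hlim
  have hKlim : Tendsto (fun s x y => ‖q s x - q s y‖ ^ 2) U (𝓝 K) :=
    tendsto_pi_nhds.2 fun x => tendsto_pi_nhds.2 (hK x)
  refine ⟨K, isClosed_setOf_isCondNegDef.mem_of_tendsto hKlim <|
    .of_forall fun s => isCondNegDef_norm_sub_sq (q s), hKd, fun x hx y hy => ?_⟩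
  refine tendsto_nhds_unique (hK x y) (tendsto_const_nhds.congr' ?_)
  filter_upwards [hmem x, hmem y] with s hxs hys
  rw [hqp s x hxs hx, hqp s y hys hy]

end HolderExtension

section Averaging

variable {G : Type u} [Group G] [TopologicalSpace G]

theorem IsAmenableGroup.exists_invariant_kernel (hG : IsAmenableGroup G) {C : Set (G → G → ℝ)}
    (hne : C.Nonempty) (hcompact : IsCompact C) (hconvex : Convex ℝ C)
    (htranslate : ∀ g, ∀ K ∈ C, (fun x y => K (g * x) (g * y)) ∈ C)
    (hcont : ∀ x y, Continuous fun q : G × C => (q.2 : G → G → ℝ) (q.1⁻¹ * x) (q.1⁻¹ * y)) :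
    ∃ K ∈ C, ∀ g x y, K (g * x) (g * y) = K x y := by
  let _ : MulAction G C :=
    { smul g K := ⟨fun x y => (K : G → G → ℝ) (g⁻¹ * x) (g⁻¹ * y), htranslate g⁻¹ K K.2⟩
      one_smul K := Subtype.ext <| funext₂ fun x y => by
        change (K : G → G → ℝ) (1⁻¹ * x) (1⁻¹ * y) = _
        simp
      mul_smul g h K := Subtype.ext <| funext₂ fun x y => by
        change (K : G → G → ℝ) ((g * h)⁻¹ * x) ((g * h)⁻¹ * y) =
          (K : G → G → ℝ) (h⁻¹ * (g⁻¹ * x)) (h⁻¹ * (g⁻¹ * y))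
        simp only [mul_inv_rev, mul_assoc] }
  have hsmul : ∀ (g : G) (K : C) (x y : G),
      (↑(g • K) : G → G → ℝ) x y = (K : G → G → ℝ) (g⁻¹ * x) (g⁻¹ * y) := fun _ _ _ _ => rfl
  have : ContinuousSMul G C :=
    ⟨Continuous.subtype_mk (continuous_pi fun x => continuous_pi (hcont x)) _⟩
  obtain ⟨K, hK⟩ := hG (G → G → ℝ) C hne hcompact hconvex fun g K L N s t _ _ _ hN => by
    ext x y
    simp only [hsmul, hN, Pi.add_apply, Pi.smul_apply]
  refine ⟨K, K.2, fun g x y => ?_⟩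
  simpa only [hsmul, inv_mul_cancel_left] using
    congrArg (fun L : C => (L : G → G → ℝ) (g * x) (g * y)) (hK g).symm

variable [IsTopologicalGroup G] {d : Ecart G}

theorem continuous_translate_of_isCondNegDef_of_le (hd : d.IsContinuousLeftInvariant)
    {C : Set (G → G → ℝ)} (hC : ∀ K ∈ C, IsCondNegDef K) (hCd : ∀ K ∈ C, K ≤ d.toFun) (x y : G) :
    Continuous fun q : G × C => (q.2 : G → G → ℝ) (q.1⁻¹ * x) (q.1⁻¹ * y) := by
  suffices hsqrt : Continuous fun q : G × C => √((q.2 : G → G → ℝ) (q.1⁻¹ * x) (q.1⁻¹ * y)) by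
    exact (hsqrt.pow 2).congr fun q => Real.sq_sqrt ((hC _ q.2.2).nonneg _ _)
  refine continuous_iff_continuousAt.2 fun ⟨g₀, K₀⟩ => tendsto_iff_dist_tendsto_zero.2 ?_
  have hdisplacement : ∀ z : G, Continuous fun q : G × C =>
      √(d.toFun (q.1⁻¹ * z) (g₀⁻¹ * z)) := fun z =>
    (hd.1.comp (f := fun q : G × C => (q.1⁻¹ * z, g₀⁻¹ * z)) (by fun_prop)).sqrt
  have heval : Continuous fun q : G × C =>
      |√((q.2 : G → G → ℝ) (g₀⁻¹ * x) (g₀⁻¹ * y)) -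
        √((K₀ : G → G → ℝ) (g₀⁻¹ * x) (g₀⁻¹ * y))| :=
    (((continuous_apply_apply _ _).comp
      (continuous_subtype_val.comp continuous_snd)).sqrt.sub continuous_const).abs
  have hbound := (((hdisplacement x).add (hdisplacement y)).add heval).tendsto (g₀, K₀)
  simp only [Pi.add_apply, d.self, Real.sqrt_zero, sub_self, abs_zero, add_zero] at hbound
  refine squeeze_zero (fun _ => dist_nonneg) (fun q => ?_) hbound
  calc dist √((q.2 : G → G → ℝ) (q.1⁻¹ * x) (q.1⁻¹ * y))
        √((K₀ : G → G → ℝ) (g₀⁻¹ * x) (g₀⁻¹ * y))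
      ≤ |√((q.2 : G → G → ℝ) (q.1⁻¹ * x) (q.1⁻¹ * y)) -
          √((q.2 : G → G → ℝ) (g₀⁻¹ * x) (g₀⁻¹ * y))| + _ := abs_sub_le _ _ _
    _ ≤ √(d.toFun (q.1⁻¹ * x) (g₀⁻¹ * x)) + √(d.toFun (q.1⁻¹ * y) (g₀⁻¹ * y)) + _ := by
        gcongr
        refine ((hC _ q.2.2).abs_sqrt_sub_sqrt_le _ _ _ _).trans ?_
        gcongr <;> exact hCd _ q.2.2 _ _

theorem IsAmenableGroup.exists_invariant_isCondNegDef (hG : IsAmenableGroup G)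
    (hd : d.IsContinuousLeftInvariant) {ρ K : G → G → ℝ}
    (hρ : ∀ g x y, ρ (g * x) (g * y) = ρ x y) (hK : IsCondNegDef K) (hρK : ρ ≤ K)
    (hKd : K ≤ d.toFun) :
    ∃ L, IsCondNegDef L ∧ ρ ≤ L ∧ L ≤ d.toFun ∧ ∀ g x y, L (g * x) (g * y) = L x y := by
  obtain ⟨L, ⟨hL, hρL, hLd⟩, hLinv⟩ := hG.exists_invariant_kernel
    (C := {K | IsCondNegDef K} ∩ Icc ρ d.toFun) ⟨K, hK, hρK, hKd⟩
    (isCompact_Icc.inter_left isClosed_setOf_isCondNegDef)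
    (convex_setOf_isCondNegDef.inter (convex_Icc ρ d.toFun))
    (fun g L hL => ⟨hL.1.comp (g * ·), fun x y => (hρ g x y).symm.trans_le (hL.2.1 _ _),
      fun x y => (hL.2.2 _ _).trans_eq (hd.2 g x y)⟩)
    (continuous_translate_of_isCondNegDef_of_le hd (fun _ hL => hL.1) fun _ hL => hL.2.2)
  exact ⟨L, hL, hρL, hLd, hLinv⟩

end Averaging

section ContinuousEcarts

theorem uniformContinuous_of_forall_dist_lt {X : Type*} [PseudoMetricSpace X] {f : X → ℝ}
    {δ c : ℝ} (hδ : 0 < δ) (hc : 0 ≤ c)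
    (hf : ∀ x y, dist x y < δ → f y ≤ f x + c * dist x y) : UniformContinuous f := by
  refine Metric.uniformContinuous_iff.2 fun ε hε =>
    ⟨min δ (ε / (c + 1)), by positivity, fun x y hxy => ?_⟩
  have hε' : (c + 1) * dist x y < ε :=
    (lt_div_iff₀' (by positivity)).1 (hxy.trans_le (min_le_right _ _))
  have hδ' : dist x y < δ := hxy.trans_le (min_le_left _ _)
  have hy := hf x y hδ'
  have hx := hf y x (dist_comm x y ▸ hδ')
  rw [dist_comm y x] at hx
  rw [Real.dist_eq, abs_lt]
  constructor <;> linarith [dist_nonneg (x := x) (y := y)]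

theorem exists_uniformContinuous_le_of_forall_dist_lt {X : Type*} [PseudoMetricSpace X]
    {φ : X → ℝ} {δ M : ℝ} (hδ : 0 < δ) (hM : 0 ≤ M)
    (hφ : ∀ x y, dist x y < δ → φ x ≤ φ y + M) :
    ∃ f : X → ℝ, UniformContinuous f ∧ ∀ x, f x ≤ φ x ∧ φ x ≤ f x + M := by
  set c := 2 * M / δ
  have hc : 0 ≤ c := by positivity
  let value (x : X) (y : Metric.ball x δ) : ℝ := φ y + c * dist (y : X) x
  have hvalue_ge : ∀ x y, φ x - M ≤ value x y := fun x y => by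
    have := hφ x y (Metric.mem_ball'.1 y.2)
    have : 0 ≤ c * dist (y : X) x := by positivity
    simp only [value]
    linarith
  have hball : ∀ x : X, Nonempty (Metric.ball x δ) := fun x => ⟨⟨x, Metric.mem_ball_self hδ⟩⟩
  let f (x : X) : ℝ := ⨅ y, value x y
  have hf_le : ∀ x y, dist y x < δ → f x ≤ φ y + c * dist y x := fun x y hy =>
    ciInf_le (f := value x) ⟨φ x - M, forall_mem_range.2 (hvalue_ge x)⟩ ⟨y, hy⟩
  have hf_le_self : ∀ x, f x ≤ φ x := fun x => by simpa using hf_le x x (by simpa using hδ)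
  have hlipschitz : ∀ x x', dist x x' < δ / 2 → f x' ≤ f x + c * dist x x' := fun x x' hxx' =>
    sub_le_iff_le_add.1 <| le_ciInf fun y => by
      rcases lt_or_ge (dist (y : X) x) (δ / 2) with hy | hy
      · have htriangle := dist_triangle (y : X) x x'
        have := hf_le x' y (by linarith)
        have := mul_le_mul_of_nonneg_left htriangle hc
        simp only [value]
        linarith
      · have hcδ : c * (δ / 2) = M := by simp only [c]; field_simp
        have := mul_le_mul_of_nonneg_left hy hc
        have := hφ x y (Metric.mem_ball'.1 y.2)
        have := hf_le x' x (by linarith)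
        simp only [value]
        linarith
  exact ⟨f, uniformContinuous_of_forall_dist_lt (half_pos hδ) hc hlipschitz,
    fun x => ⟨hf_le_self x, sub_le_iff_le_add.1 (le_ciInf (hvalue_ge x))⟩⟩

namespace Ecart

theorem nonneg {X : Type u} (d : Ecart X) (x y : X) : 0 ≤ d.toFun x y := by
  linarith [d.triangle x y x, d.self x, d.symm x y]

/-- The multiple of an écart by a nonnegative real number. -/
def scale {X : Type u} (d : Ecart X) {r : ℝ} (hr : 0 ≤ r) : Ecart X where
  toFun x y := r * d.toFun x y
  self x := by rw [d.self, mul_zero]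
  symm x y := by rw [d.symm]
  triangle x y z := by
    rw [← mul_add]
    exact mul_le_mul_of_nonneg_left (d.triangle x y z) hr

variable {G : Type u} [Group G]

/-- The least left-invariant écart dominating the écart `(x, y) ↦ dist (f x) (f y)` on a group,
for a map `f` whose displacements `dist (f (z * x)) (f (z * y))` are bounded in `z`. -/
noncomputable def leftSup {Y : Type*} [PseudoMetricSpace Y] (f : G → Y)
    (hf : ∀ x y, BddAbove (range fun z => dist (f (z * x)) (f (z * y)))) : Ecart G where
  toFun x y := ⨆ z, dist (f (z * x)) (f (z * y))
  self x := by simp only [dist_self, ciSup_const]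
  symm x y := by simp only [dist_comm]
  triangle x y z := ciSup_le fun w => (dist_triangle _ (f (w * y)) _).trans
    (add_le_add (le_ciSup (hf x y) w) (le_ciSup (hf y z) w))

section LeftSup

variable {Y : Type*} [PseudoMetricSpace Y] {f : G → Y}
  (hf : ∀ x y, BddAbove (range fun z => dist (f (z * x)) (f (z * y))))

theorem dist_le_leftSup (x y : G) : dist (f x) (f y) ≤ (leftSup f hf).toFun x y := by
  simpa only [one_mul] using! le_ciSup (hf x y) 1

theorem leftSup_mul_left (g x y : G) :
    (leftSup f hf).toFun (g * x) (g * y) = (leftSup f hf).toFun x y := by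
  simpa only [leftSup, Equiv.coe_mulRight, mul_assoc] using
    (Equiv.mulRight g).iSup_comp (g := fun z => dist (f (z * x)) (f (z * y)))

theorem leftSup_one_le {g : G} {c : ℝ} (h : ∀ z, dist (f z) (f (z * g)) ≤ c) :
    (leftSup f hf).toFun 1 g ≤ c :=
  ciSup_le fun z => by simpa only [mul_one] using h z

end LeftSup

theorem eq_one_left {d : Ecart G} (hinv : ∀ g x y, d.toFun (g * x) (g * y) = d.toFun x y)
    (x y : G) : d.toFun x y = d.toFun 1 (x⁻¹ * y) := by
  rw [← hinv x⁻¹ x y, inv_mul_cancel]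

variable [TopologicalSpace G]

theorem IsContinuousLeftInvariant.scale {d : Ecart G} (hd : d.IsContinuousLeftInvariant)
    {r : ℝ} (hr : 0 ≤ r) : (d.scale hr).IsContinuousLeftInvariant :=
  ⟨continuous_const.mul hd.1, fun g x y => congrArg (r * ·) (hd.2 g x y)⟩

theorem isContinuousLeftInvariant_of_tendsto [ContinuousMul G] {d : Ecart G}
    (hinv : ∀ g x y, d.toFun (g * x) (g * y) = d.toFun x y)
    (hd : Tendsto (d.toFun 1) (𝓝 1) (𝓝 0)) : d.IsContinuousLeftInvariant := by
  refine ⟨continuous_iff_continuousAt.2 fun ⟨x, y⟩ => tendsto_iff_dist_tendsto_zero.2 ?_, hinv⟩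
  have hnear : ∀ x : G, Tendsto (fun z => d.toFun x z) (𝓝 x) (𝓝 0) := fun x => by
    have hx : Tendsto (fun z => x⁻¹ * z) (𝓝 x) (𝓝 1) :=
      (continuous_const_mul x⁻¹).tendsto' x 1 (inv_mul_cancel x)
    simpa only [Function.comp_def, ← eq_one_left hinv] using hd.comp hx
  have hbound : Tendsto (fun p : G × G => d.toFun x p.1 + d.toFun y p.2) (𝓝 (x, y)) (𝓝 0) := by
    rw [nhds_prod_eq]
    simpa only [add_zero, Function.comp_def] using
      ((hnear x).comp tendsto_fst).add ((hnear y).comp tendsto_snd)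
  refine squeeze_zero (fun _ => dist_nonneg) (fun p => abs_sub_le_iff.2 ⟨?_, ?_⟩) hbound
  · linarith [d.triangle p.1 x p.2, d.triangle x y p.2, d.symm p.1 x]
  · linarith [d.triangle x p.1 y, d.triangle p.1 p.2 y, d.symm p.2 y]

theorem exists_isContinuousLeftInvariant_le_add [IsTopologicalGroup G]
    [FirstCountableTopology G] {D : Ecart G} {M : ℝ}
    (hinv : ∀ g x y, D.toFun (g * x) (g * y) = D.toFun x y)
    (hD : ∀ᶠ g in 𝓝 1, D.toFun 1 g ≤ M) :
    ∃ d : Ecart G, d.IsContinuousLeftInvariant ∧ ∀ x y, D.toFun x y ≤ d.toFun x y + M := by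
  let _ : UniformSpace G := IsTopologicalGroup.leftUniformSpace G
  have huniformity : uniformity G = comap (fun p : G × G => p.1⁻¹ * p.2) (𝓝 1) := rfl
  have : (uniformity G).IsCountablyGenerated := huniformity ▸ inferInstance
  let _ : PseudoMetricSpace G := UniformSpace.pseudoMetricSpace G
  obtain ⟨δ, hδ, hDδ⟩ := Metric.mem_uniformity_dist.1 (huniformity ▸ preimage_mem_comap hD)
  have hM : 0 ≤ M := (D.nonneg 1 1).trans hD.self_of_nhds
  obtain ⟨f, hf, hfD⟩ := exists_uniformContinuous_le_of_forall_dist_lt (φ := D.toFun 1) hδ hM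
    fun x y hxy => by
      have : D.toFun x y ≤ M := (eq_one_left hinv x y).trans_le (hDδ hxy)
      linarith [D.triangle 1 y x, D.symm x y]
  have hbdd : ∀ x y, BddAbove (range fun z => dist (f (z * x)) (f (z * y))) := fun x y => by
    refine ⟨D.toFun x y + M, forall_mem_range.2 fun z => abs_sub_le_iff.2 ⟨?_, ?_⟩⟩ <;>
    linarith [hfD (z * x), hfD (z * y), D.triangle 1 (z * x) (z * y),
      D.triangle 1 (z * y) (z * x), D.symm (z * x) (z * y), hinv z x y]
  refine ⟨leftSup f hbdd, isContinuousLeftInvariant_of_tendsto (leftSup_mul_left hbdd) ?_,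
    fun x y => ?_⟩
  · refine Metric.tendsto_nhds.2 fun ε hε => ?_
    have hfε : ∀ᶠ g in 𝓝 (1 : G), ∀ p : G × G, p.1⁻¹ * p.2 = g → dist (f p.1) (f p.2) < ε / 2 :=
      eventually_comap.1 (huniformity ▸ hf (Metric.dist_mem_uniformity (half_pos hε)))
    filter_upwards [hfε] with g hg
    rw [Real.dist_0_eq_abs, abs_of_nonneg (nonneg _ _ _)]
    exact (leftSup_one_le hbdd fun z => (hg (z, z * g) (inv_mul_cancel_left z g)).le).trans_lt
      (half_lt_self hε)
  · rw [eq_one_left hinv, eq_one_left (leftSup_mul_left hbdd)]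
    have hdist := (abs_sub_le_iff.1 (dist_le_leftSup hbdd 1 (x⁻¹ * y))).2
    linarith [(hfD (x⁻¹ * y)).2, (hfD 1).1, D.self 1]

end Ecart

end ContinuousEcarts

section Coarse

variable {G : Type u} [Group G] [TopologicalSpace G] {Y : Type v} [PseudoMetricSpace Y] {σ : G → Y}

theorem mem_leftCoarse_of_bddAbove {A : Set G}
    (hA : ∀ d : Ecart G, d.IsContinuousLeftInvariant → BddAbove (d.toFun 1 '' A)) :
    {p : G × G | p.1⁻¹ * p.2 ∈ A} ∈ (leftCoarse G).entourages := by
  intro d hd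
  obtain ⟨r, hr⟩ := hA d hd
  refine ⟨r + 1, fun p hp => ?_⟩
  rw [Ecart.eq_one_left hd.2]
  exact (hr ⟨_, hp, rfl⟩).trans_lt (lt_add_one r)

theorem IsBornologous.exists_dist_lt
    (hσ : IsBornologous (leftCoarse G) (metricEcart Y).coarse σ) {A : Set G}
    (hA : ∀ d : Ecart G, d.IsContinuousLeftInvariant → BddAbove (d.toFun 1 '' A)) :
    ∃ r : ℝ, ∀ x y, x⁻¹ * y ∈ A → dist (σ x) (σ y) < r := by
  obtain ⟨F, ⟨r, hr⟩, hF⟩ := hσ _ (mem_leftCoarse_of_bddAbove hA)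
  exact ⟨r, fun x y hxy => hr _ (hF x y hxy)⟩

theorem IsBornologous.exists_eventually_dist_le [FirstCountableTopology G]
    (hσ : IsBornologous (leftCoarse G) (metricEcart Y).coarse σ) :
    ∃ M : ℝ, ∀ᶠ g in 𝓝 (1 : G), ∀ x, dist (σ x) (σ (x * g)) ≤ M := by
  by_contra! hunbounded
  obtain ⟨V, hV⟩ := (𝓝 (1 : G)).exists_antitone_basis
  have hlarge : ∀ n : ℕ, ∃ g ∈ V n, ∃ x, (n : ℝ) < dist (σ x) (σ (x * g)) := fun n => by
    obtain ⟨g, ⟨x, hx⟩, hg⟩ := ((hunbounded n).and_eventually (hV.1.mem_of_mem trivial)).exists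
    exact ⟨g, hg, x, hx⟩
  choose g hgV x hx using hlarge
  obtain ⟨r, hr⟩ := hσ.exists_dist_lt (A := range g) fun d hd => by
    have hd1 : Continuous (d.toFun 1) := hd.1.comp (Continuous.prodMk_right 1)
    rw [← range_comp]
    exact ((hd1.tendsto 1).comp (hV.tendsto hgV)).bddAbove_range
  obtain ⟨n, hn⟩ := exists_nat_gt r
  have := hr (x n) (x n * g n) (by simp)
  linarith [hx n]

theorem IsBornologous.exists_dist_le_add [IsTopologicalGroup G] [FirstCountableTopology G]
    (hσ : IsBornologous (leftCoarse G) (metricEcart Y).coarse σ) :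
    ∃ (d : Ecart G) (M : ℝ), d.IsContinuousLeftInvariant ∧
      ∀ x y, dist (σ x) (σ y) ≤ d.toFun x y + M := by
  have hbdd : ∀ x y, BddAbove (range fun z => dist (σ (z * x)) (σ (z * y))) := fun x y => by
    obtain ⟨r, hr⟩ := hσ.exists_dist_lt (A := {x⁻¹ * y}) fun d _ => by simp
    exact ⟨r, forall_mem_range.2 fun z => (hr (z * x) (z * y) (by simp [mul_assoc])).le⟩
  obtain ⟨M, hM⟩ := hσ.exists_eventually_dist_le
  obtain ⟨d, hd, hle⟩ := Ecart.exists_isContinuousLeftInvariant_le_add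
    (Ecart.leftSup_mul_left hbdd) (hM.mono fun g hg => Ecart.leftSup_one_le hbdd hg)
  exact ⟨d, M, hd, fun x y => (Ecart.dist_le_leftSup hbdd x y).trans (hle x y)⟩

theorem IsExpanding.setOf_iInf_dist_lt_mem
    (hσ : IsExpanding (leftCoarse G) (metricEcart Y).coarse σ) (r : ℝ) :
    {p : G × G | ⨅ z, dist (σ (z * p.1)) (σ (z * p.2)) < r} ∈ (leftCoarse G).entourages := by
  intro d hd
  obtain ⟨E, hE, hσE⟩ := hσ {p | dist p.1 p.2 < r} ⟨r, fun _ hp => hp⟩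
  obtain ⟨s, hs⟩ := hE d hd
  refine ⟨s, fun p hp => ?_⟩
  obtain ⟨z, hz⟩ := exists_lt_of_ciInf_lt (mem_ofPred_eq ▸ hp)
  rw [← hd.2 z]
  exact hs (z * p.1, z * p.2) (not_imp_not.1 (hσE _ _) hz)

end Coarse

section ApproximatingKernel

theorem Ecart.exists_maximal_separated {X : Type u} (d : Ecart X) :
    ∃ N : Set X, N.Pairwise (fun x y => 1 ≤ d.toFun x y) ∧ ∀ x, ∃ y ∈ N, d.toFun x y < 1 := by
  obtain ⟨N, hN⟩ := zorn_subset {N : Set X | N.Pairwise fun x y => 1 ≤ d.toFun x y}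
    fun c hc hchain => ⟨⋃₀ c, (pairwise_sUnion hchain.directedOn).2 hc,
      fun s hs => subset_sUnion_of_mem hs⟩
  refine ⟨N, hN.prop, fun x => ?_⟩
  by_contra! hfar
  have hinsert : (insert x N).Pairwise fun x y => 1 ≤ d.toFun x y :=
    hN.prop.insert fun y hy _ => ⟨hfar y hy, d.symm x y ▸ hfar y hy⟩
  have hx : x ∈ N := hN.le_of_ge hinsert (subset_insert x N) (mem_insert x N)
  linarith [hfar x hx, d.self x]

theorem exists_isCondNegDef_norm_sub_le {X : Type u} {E : Type v} [NormedAddCommGroup E]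
    [InnerProductSpace ℝ E] {σ : X → E} {d : Ecart X} {M : ℝ} (hM : 0 ≤ M)
    (hσ : ∀ x y, ‖σ x - σ y‖ ≤ d.toFun x y + M) :
    ∃ K, IsCondNegDef K ∧ (∀ x y, K x y ≤ (1 + M) * d.toFun x y) ∧
      ∀ x y, ‖σ x - σ y‖ ≤ 2 * K x y + 10 * (1 + M) := by
  rcases isEmpty_or_nonempty X with _ | ⟨⟨o⟩⟩
  · exact ⟨_, isCondNegDef_norm_sub σ, isEmptyElim, isEmptyElim⟩
  obtain ⟨N, hsep, hnear⟩ := d.exists_maximal_separated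
  obtain ⟨H, _, _, _, τ, hτ, -, -⟩ := (isCondNegDef_norm_sub σ).exists_norm_sub_sq_eq o
  have hM' : 0 ≤ 1 + M := by positivity
  obtain ⟨K, hK, hKd, hKN⟩ :=
    (d.scale hM').exists_isCondNegDef_extension (N := N) (p := τ) fun x hx y hy => by
      rcases eq_or_ne x y with rfl | hxy
      · simp [(d.scale hM').self]
      · calc ‖τ x - τ y‖ ^ 2 = ‖σ x - σ y‖ := hτ x y
          _ ≤ d.toFun x y + M := hσ x y
          _ ≤ (1 + M) * d.toFun x y := by nlinarith [hsep hx hy hxy]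
  have hKnear : ∀ x a, d.toFun x a < 1 → √(K x a) ≤ √(1 + M) := fun x a hxa =>
    Real.sqrt_le_sqrt ((hKd x a).trans (mul_le_of_le_one_right hM' hxa.le))
  refine ⟨K, hK, hKd, fun x y => ?_⟩
  obtain ⟨a, ha, hxa⟩ := hnear x
  obtain ⟨b, hb, hyb⟩ := hnear y
  have hsqrt : √(K a b) ≤ √(K x y) + 2 * √(1 + M) := by
    have := (le_abs_self _).trans (hK.abs_sqrt_sub_sqrt_le a b x y)
    rw [hK.symm a x, hK.symm b y] at this
    linarith [hKnear x a hxa, hKnear y b hyb]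
  have hab : ‖σ a - σ b‖ ≤ 2 * K x y + 8 * (1 + M) := by
    calc ‖σ a - σ b‖ = √(K a b) ^ 2 := by rw [Real.sq_sqrt (hK.nonneg a b), hKN a ha b hb, hτ]
      _ ≤ (√(K x y) + 2 * √(1 + M)) ^ 2 := by gcongr
      _ ≤ 2 * (√(K x y) ^ 2 + (2 * √(1 + M)) ^ 2) := add_sq_le
      _ = 2 * K x y + 8 * (1 + M) := by
        rw [mul_pow, Real.sq_sqrt (hK.nonneg x y), Real.sq_sqrt hM']
        ring
  calc ‖σ x - σ y‖ ≤ ‖σ x - σ a‖ + ‖σ a - σ b‖ + ‖σ b - σ y‖ := by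
        simpa only [dist_eq_norm] using dist_triangle4 (σ x) (σ a) (σ b) (σ y)
    _ ≤ 2 * K x y + 10 * (1 + M) := by
        linarith [hσ x a, hσ y b, norm_sub_rev (σ b) (σ y)]

theorem IsCoarseEmbedding.exists_invariant_isCondNegDef {G : Type u} [Group G]
    [TopologicalSpace G] [IsTopologicalGroup G] [FirstCountableTopology G]
    (hG : IsAmenableGroup G) {E : Type v} [NormedAddCommGroup E] [InnerProductSpace ℝ E]
    {σ : G → E} (hσ : IsCoarseEmbedding (leftCoarse G) (metricEcart E).coarse σ) :
    ∃ (d : Ecart G) (K : G → G → ℝ), d.IsContinuousLeftInvariant ∧ IsCondNegDef K ∧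
      (∀ g x y, K (g * x) (g * y) = K x y) ∧ K ≤ d.toFun ∧
      ∀ r, {p : G × G | K p.1 p.2 < r} ∈ (leftCoarse G).entourages := by
  obtain ⟨d, M, hd, hσd⟩ := hσ.1.exists_dist_le_add
  have hM : 0 ≤ M := by simpa [d.self] using hσd 1 1
  have hM' : 0 ≤ 1 + M := by positivity
  obtain ⟨K, hK, hKd, hσK⟩ :=
    exists_isCondNegDef_norm_sub_le hM (by simpa only [dist_eq_norm] using hσd)
  let displacement (x y : G) : ℝ := ⨅ z, dist (σ (z * x)) (σ (z * y))
  let ρ (x y : G) : ℝ := (displacement x y - 10 * (1 + M)) / 2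
  have hdisplacement_inv : ∀ g x y, displacement (g * x) (g * y) = displacement x y :=
    fun g x y => by
      simpa only [displacement, Equiv.coe_mulRight, mul_assoc] using
        (Equiv.mulRight g).iInf_comp (g := fun z => dist (σ (z * x)) (σ (z * y)))
  have hdisplacement_le : ∀ x y, displacement x y ≤ ‖σ x - σ y‖ := fun x y => by
    have hbdd : BddBelow (range fun z => dist (σ (z * x)) (σ (z * y))) :=
      ⟨0, forall_mem_range.2 fun _ => dist_nonneg⟩
    simpa only [one_mul, ← dist_eq_norm] using ciInf_le hbdd 1
  obtain ⟨L, hL, hρL, hLd, hLinv⟩ := hG.exists_invariant_isCondNegDef (hd.scale hM') (ρ := ρ)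
    (fun g x y => by simp only [ρ, hdisplacement_inv]) hK
    (fun x y => by
      simp only [ρ]
      linarith [hdisplacement_le x y, hσK x y]) hKd
  refine ⟨d.scale hM', L, hd.scale hM', hL, hLinv, hLd, fun r =>
    (leftCoarse G).subset_mem _ _ (fun p hp => ?_)
      (hσ.2.setOf_iInf_dist_lt_mem (2 * r + 10 * (1 + M)))⟩
  have hlt : ρ p.1 p.2 < r := (hρL _ _).trans_lt hp
  simp only [ρ] at hlt
  exact (by linarith : displacement p.1 p.2 < 2 * r + 10 * (1 + M))

end ApproximatingKernel

section Cocycle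

theorem exists_linearIsometryEquiv_of_inner_eq {𝕜 X E F : Type*} [RCLike 𝕜]
    [NormedAddCommGroup E] [InnerProductSpace 𝕜 E] [CompleteSpace E]
    [NormedAddCommGroup F] [InnerProductSpace 𝕜 F] [CompleteSpace F] {b : X → E} {c : X → F}
    (hbc : ∀ x y, ⟪c x, c y⟫_𝕜 = ⟪b x, b y⟫_𝕜)
    (hb : Dense (Submodule.span 𝕜 (range b) : Set E))
    (hc : Dense (Submodule.span 𝕜 (range c) : Set F)) :
    ∃ T : E ≃ₗᵢ[𝕜] F, ∀ x, T (b x) = c x := by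
  have hdense_b : DenseRange (Finsupp.linearCombination 𝕜 b) := by
    rwa [← Finsupp.range_linearCombination] at hb
  have hdense_c : DenseRange (Finsupp.linearCombination 𝕜 c) := by
    rwa [← Finsupp.range_linearCombination] at hc
  have hnorm : ∀ a : X →₀ 𝕜,
      ‖Finsupp.linearCombination 𝕜 c a‖ = ‖Finsupp.linearCombination 𝕜 b a‖ := fun a => by
    simp only [norm_eq_sqrt_re_inner (𝕜 := 𝕜), Finsupp.linearCombination_apply, Finsupp.sum,
      sum_inner, inner_sum, inner_smul_left, inner_smul_right, hbc]
  refine ⟨(LinearEquiv.refl 𝕜 (X →₀ 𝕜)).extendOfIsometry _ _ hdense_b hdense_c hnorm, fun x => ?_⟩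
  simpa using LinearEquiv.extendOfIsometry_eq (LinearEquiv.refl 𝕜 (X →₀ 𝕜)) _ _
    hdense_b hdense_c hnorm (Finsupp.single x 1)

variable {G : Type u} [Group G]

theorem IsCondNegDef.exists_cocycle {K : G → G → ℝ} (hK : IsCondNegDef K)
    (hinv : ∀ g x y, K (g * x) (g * y) = K x y) :
    ∃ (H : Type u) (_ : NormedAddCommGroup H) (_ : InnerProductSpace ℝ H) (_ : CompleteSpace H)
      (π : G →* (H ≃ₗᵢ[ℝ] H)) (b : G → H), (∀ g h, b (g * h) = π g (b h) + b g) ∧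
      (∀ x y, ‖b x - b y‖ ^ 2 = K x y) ∧ Dense (Submodule.span ℝ (range b) : Set H) := by
  obtain ⟨H, _, _, _, b, hbK, hb1, hdense⟩ := hK.exists_norm_sub_sq_eq 1
  have hinner : ∀ g x y, ⟪b (g * x) - b g, b (g * y) - b g⟫_ℝ = ⟪b x, b y⟫_ℝ := fun g x y => by
    have hbK1 : ∀ x, ‖b x‖ ^ 2 = K x 1 := fun x => by rw [← hbK, hb1, sub_zero]
    have hbKg : ∀ x, ‖b (g * x) - b g‖ ^ 2 = K x 1 := fun x => by
      rw [hbK, ← hinv g x 1, mul_one]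
    have hsub := norm_sub_sq_real (b x) (b y)
    have hsub_g := norm_sub_sq_real (b (g * x) - b g) (b (g * y) - b g)
    rw [sub_sub_sub_cancel_right, hbK, hinv, hbKg, hbKg] at hsub_g
    rw [hbK, hbK1, hbK1] at hsub
    linarith
  have hdense_g : ∀ g, Dense (Submodule.span ℝ (range fun h => b (g * h) - b g) : Set H) := by
    refine fun g => hdense.mono (Submodule.span_le.2 (range_subset_iff.2 fun h => ?_))
    have hmem : ∀ h, b (g * h) - b g ∈ Submodule.span ℝ (range fun h => b (g * h) - b g) :=
      fun h => Submodule.subset_span ⟨h, rfl⟩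
    simpa [hb1] using Submodule.sub_mem _ (hmem (g⁻¹ * h)) (hmem g⁻¹)
  choose T hT using fun g => exists_linearIsometryEquiv_of_inner_eq (hinner g) hdense (hdense_g g)
  have hT_mul : ∀ g h, T (g * h) = T g * T h := fun g h => by
    have heqOn : EqOn (T (g * h)).toContinuousLinearEquiv.toContinuousLinearMap
        (T g * T h).toContinuousLinearEquiv.toContinuousLinearMap (range b) := by
      rintro _ ⟨x, rfl⟩
      change T (g * h) (b x) = T g (T h (b x))
      rw [hT, hT, map_sub, hT, hT, mul_assoc, sub_sub_sub_cancel_right]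
    exact LinearIsometryEquiv.ext fun v =>
      DFunLike.congr_fun (ContinuousLinearMap.ext_on hdense heqOn) v
  exact ⟨H, inferInstance, inferInstance, inferInstance, MonoidHom.mk' T hT_mul, b,
    fun g h => ((congrArg (· + b g) (hT g h)).trans (sub_add_cancel _ _)).symm, hbK, hdense⟩

theorem continuous_of_continuous_cocycle [TopologicalSpace G] [ContinuousMul G] {𝕜 E : Type*}
    [NormedField 𝕜] [SeminormedAddCommGroup E] [NormedSpace 𝕜 E]
    {π : G →* (E ≃ₗᵢ[𝕜] E)} {b : G → E} (hπb : ∀ g h, b (g * h) = π g (b h) + b g)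
    (hb : Continuous b) (hdense : Dense (Submodule.span 𝕜 (range b) : Set E)) :
    Continuous fun p : G × E => π p.1 p.2 := by
  have hspan : ∀ v ∈ Submodule.span 𝕜 (range b), Continuous fun g => π g v := fun v hv => by
    induction hv using Submodule.span_induction with
    | mem v hv =>
      obtain ⟨h, rfl⟩ := hv
      have hπ : (fun g => π g (b h)) = fun g => b (g * h) - b g :=
        funext fun g => eq_sub_of_add_eq (hπb g h).symm
      rw [hπ]
      fun_prop
    | zero => simpa only [map_zero] using continuous_const
    | add v w _ _ hv hw => simpa only [map_add] using! hv.add hw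
    | smul r v _ hv => simpa only [map_smul] using! hv.const_smul r
  exact continuous_prod_of_dense_continuous_lipschitzWith' _ 1 hdense
    (fun g => (π g).lipschitz) hspan

/-- The affine isometric action `g • v = π g v + b g` defined by a linear isometric representation
`π` and a cocycle `b` for it. -/
noncomputable def affineAction {𝕜 E : Type*} [NormedField 𝕜] [SeminormedAddCommGroup E]
    [NormedSpace 𝕜 E] (π : G →* (E ≃ₗᵢ[𝕜] E)) (b : G → E)
    (hπb : ∀ g h, b (g * h) = π g (b h) + b g) : G →* (E ≃ᵃⁱ[𝕜] E) :=
  MonoidHom.mk'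
    (fun g => (π g).toAffineIsometryEquiv.trans (AffineIsometryEquiv.constVAdd 𝕜 E (b g)))
    fun g h => by
      ext v
      simp [hπb, add_comm, add_left_comm]

theorem affineAction_apply {𝕜 E : Type*} [NormedField 𝕜] [SeminormedAddCommGroup E]
    [NormedSpace 𝕜 E] {π : G →* (E ≃ₗᵢ[𝕜] E)} {b : G → E}
    (hπb : ∀ g h, b (g * h) = π g (b h) + b g) (g : G) (v : E) :
    affineAction π b hπb g v = π g v + b g :=
  add_comm (b g) (π g v)

end Cocycle

/-- A Hilbert space over `𝕜` containing the real Hilbert space `E`: the `ℓ²`-sum `E ⊕ E` on which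
`a : 𝕜` acts as the complex number `re a + im a • i`. Over `𝕜 = ℝ` it is just the real Hilbert
space `E ⊕ E`. -/
def Complexify (E : Type u) : Type u := WithLp 2 (E × E)

namespace Complexify

variable {E : Type u}

/-- The element of the complexification with given real and imaginary parts. -/
def mk (x y : E) : Complexify E := WithLp.toLp 2 (x, y)

/-- The real part of an element of the complexification. -/
def fst (p : Complexify E) : E := WithLp.fst p

/-- The imaginary part of an element of the complexification. -/
def snd (p : Complexify E) : E := WithLp.snd p

@[simp] theorem fst_mk (x y : E) : (mk x y).fst = x := rfl

@[simp] theorem snd_mk (x y : E) : (mk x y).snd = y := rfl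

@[ext] theorem ext {p q : Complexify E} (hfst : p.fst = q.fst) (hsnd : p.snd = q.snd) : p = q :=
  congrArg (WithLp.toLp 2) (Prod.ext hfst hsnd)

variable [NormedAddCommGroup E]

noncomputable instance : NormedAddCommGroup (Complexify E) :=
  inferInstanceAs (NormedAddCommGroup (WithLp 2 (E × E)))

instance [CompleteSpace E] : CompleteSpace (Complexify E) :=
  inferInstanceAs (CompleteSpace (WithLp 2 (E × E)))

@[simp] theorem fst_add (p q : Complexify E) : (p + q).fst = p.fst + q.fst := rfl

@[simp] theorem snd_add (p q : Complexify E) : (p + q).snd = p.snd + q.snd := rfl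

@[simp] theorem fst_sub (p q : Complexify E) : (p - q).fst = p.fst - q.fst := rfl

@[simp] theorem snd_sub (p q : Complexify E) : (p - q).snd = p.snd - q.snd := rfl

@[simp] theorem fst_zero : (0 : Complexify E).fst = 0 := rfl

@[simp] theorem snd_zero : (0 : Complexify E).snd = 0 := rfl

theorem norm_sq_eq (p : Complexify E) : ‖p‖ ^ 2 = ‖p.fst‖ ^ 2 + ‖p.snd‖ ^ 2 :=
  WithLp.prod_norm_sq_eq_of_L2 p

@[fun_prop] theorem continuous_fst : Continuous (fst : Complexify E → E) :=
  _root_.continuous_fst.comp (WithLp.prod_continuous_ofLp 2 E E)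

@[fun_prop] theorem continuous_snd : Continuous (snd : Complexify E → E) :=
  _root_.continuous_snd.comp (WithLp.prod_continuous_ofLp 2 E E)

theorem continuous_mk : Continuous fun p : E × E => mk p.1 p.2 :=
  WithLp.prod_continuous_toLp 2 E E

variable [InnerProductSpace ℝ E] {𝕜 : Type v} [RCLike 𝕜]

noncomputable instance : SMul 𝕜 (Complexify E) where
  smul a p := mk (RCLike.re a • p.fst - RCLike.im a • p.snd)
    (RCLike.im a • p.fst + RCLike.re a • p.snd)

@[simp] theorem fst_smul (a : 𝕜) (p : Complexify E) :
    (a • p).fst = RCLike.re a • p.fst - RCLike.im a • p.snd := rfl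

@[simp] theorem snd_smul (a : 𝕜) (p : Complexify E) :
    (a • p).snd = RCLike.im a • p.fst + RCLike.re a • p.snd := rfl

noncomputable instance : Module 𝕜 (Complexify E) where
  one_smul p := by ext <;> simp
  mul_smul a b p := by
    ext <;> simp only [fst_smul, snd_smul, RCLike.mul_re, RCLike.mul_im] <;> module
  smul_zero a := by ext <;> simp
  smul_add a p q := by
    ext <;> simp only [fst_smul, snd_smul, fst_add, snd_add] <;> module
  add_smul a b p := by
    ext <;> simp only [fst_smul, snd_smul, fst_add, snd_add, map_add] <;> module
  zero_smul p := by ext <;> simp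

noncomputable instance : NormedSpace 𝕜 (Complexify E) where
  norm_smul_le a p := by
    refine le_of_eq ((sq_eq_sq₀ (norm_nonneg _) (by positivity)).1 ?_)
    rw [mul_pow, norm_sq_eq, norm_sq_eq, RCLike.norm_sq_eq_def, fst_smul, snd_smul,
      norm_sub_sq_real, norm_add_sq_real]
    simp only [norm_smul, mul_pow, Real.norm_eq_abs, sq_abs, real_inner_smul_left,
      real_inner_smul_right]
    ring

noncomputable instance : InnerProductSpace 𝕜 (Complexify E) :=
  InnerProductSpace.ofNorm 𝕜 (parallelogram_law_with_norm_mul ℝ (E := WithLp 2 (E × E)))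

variable (𝕜) in
/-- The homomorphism letting an isometry of `E` act on the real and imaginary parts. -/
noncomputable def isometryHom : (E ≃ₗᵢ[ℝ] E) →* (Complexify E ≃ₗᵢ[𝕜] Complexify E) where
  toFun f :=
    { toFun p := mk (f p.fst) (f p.snd)
      invFun p := mk (f.symm p.fst) (f.symm p.snd)
      left_inv p := by ext <;> simp
      right_inv p := by ext <;> simp
      map_add' p q := by ext <;> simp
      map_smul' a p := by ext <;> simp
      norm_map' p := (sq_eq_sq₀ (norm_nonneg _) (norm_nonneg _)).1 (by
        simp [norm_sq_eq]) }
  map_one' := rfl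
  map_mul' _ _ := rfl

theorem isometryHom_apply (f : E ≃ₗᵢ[ℝ] E) (p : Complexify E) :
    isometryHom 𝕜 f p = mk (f p.fst) (f p.snd) := rfl

end Complexify

section Haagerup

variable {G : Type u} [Group G] [TopologicalSpace G]

theorem IsCondNegDef.exists_continuous_affineAction [ContinuousMul G] (𝕜 : Type v) [RCLike 𝕜]
    {K : G → G → ℝ} (hK : IsCondNegDef K) (hinv : ∀ g x y, K (g * x) (g * y) = K x y)
    (hcont : ∀ x, Tendsto (K x) (𝓝 x) (𝓝 0)) :
    ∃ (H : Type u) (_ : NormedAddCommGroup H) (_ : InnerProductSpace 𝕜 H) (_ : CompleteSpace H)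
      (α : G →* (H ≃ᵃⁱ[𝕜] H)), Continuous (fun p : G × H => α p.1 p.2) ∧
      ∀ x y, ‖α x 0 - α y 0‖ ^ 2 = K x y := by
  obtain ⟨E, _, _, _, π, b, hπb, hbK, hdense⟩ := hK.exists_cocycle hinv
  have hb : Continuous b := continuous_iff_continuousAt.2 fun x => by
    refine tendsto_iff_norm_sub_tendsto_zero.2 ((Real.sqrt_zero ▸ (hcont x).sqrt).congr fun y => ?_)
    rw [hK.symm, ← hbK, Real.sqrt_sq (norm_nonneg _)]
  have hπ : Continuous fun p : G × E => π p.1 p.2 := continuous_of_continuous_cocycle hπb hb hdense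
  have hcocycle : ∀ g h, Complexify.mk (b (g * h)) 0 =
      (Complexify.isometryHom 𝕜).comp π g (Complexify.mk (b h) 0) + Complexify.mk (b g) 0 :=
    fun g h => by ext <;> simp [Complexify.isometryHom_apply, hπb]
  refine ⟨Complexify E, inferInstance, inferInstance, inferInstance,
    affineAction _ (fun g => Complexify.mk (b g) 0) hcocycle, ?_, fun x y => ?_⟩
  · simp only [affineAction_apply, MonoidHom.comp_apply, Complexify.isometryHom_apply]
    have hfst : Continuous fun p : G × Complexify E => π p.1 p.2.fst :=
      hπ.comp (continuous_fst.prodMk (Complexify.continuous_fst.comp continuous_snd))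
    have hsnd : Continuous fun p : G × Complexify E => π p.1 p.2.snd :=
      hπ.comp (continuous_fst.prodMk (Complexify.continuous_snd.comp continuous_snd))
    exact (Complexify.continuous_mk.comp (hfst.prodMk hsnd)).add
      (Complexify.continuous_mk.comp ((hb.comp continuous_fst).prodMk continuous_const))
  · rw [Complexify.norm_sq_eq]
    simp [affineAction_apply, hbK]

theorem IsCondNegDef.hasHaagerupProperty [ContinuousMul G] (𝕜 : Type v) [RCLike 𝕜]
    {K : G → G → ℝ} (hK : IsCondNegDef K) (hinv : ∀ g x y, K (g * x) (g * y) = K x y)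
    {d : Ecart G} (hd : d.IsContinuousLeftInvariant) (hKd : K ≤ d.toFun)
    (hproper : ∀ r, {p : G × G | K p.1 p.2 < r} ∈ (leftCoarse G).entourages) :
    HasHaagerupProperty 𝕜 G := by
  have hcont : ∀ x, Tendsto (K x) (𝓝 x) (𝓝 0) := fun x =>
    squeeze_zero (fun y => hK.nonneg x y) (fun y => hKd x y)
      ((hd.1.comp (Continuous.prodMk_right x)).tendsto' x 0 (d.self x))
  obtain ⟨H, _, _, _, α, hα, hαK⟩ := hK.exists_continuous_affineAction 𝕜 hinv hcont
  refine ⟨H, inferInstance, inferInstance, inferInstance, α, hα, fun E hE => ?_, ?_⟩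
  · obtain ⟨r, hr⟩ := hE d hd
    refine ⟨{p | dist p.1 p.2 < √r}, ⟨√r, fun p hp => hp⟩, fun x y hxy => ?_⟩
    refine mem_ofPred_eq ▸ Real.lt_sqrt_of_sq_lt ?_
    rw [dist_eq_norm, hαK]
    exact (hKd x y).trans_lt (hr _ hxy)
  · rintro F ⟨r, hr⟩
    refine ⟨_, hproper (r ^ 2), fun x y hxy hF => hxy ?_⟩
    have hlt : ‖α x 0 - α y 0‖ < r := dist_eq_norm (α x 0) (α y 0) ▸ hr _ hF
    exact (hαK x y).symm.trans_lt (pow_lt_pow_left₀ hlt (norm_nonneg _) two_ne_zero)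

end Haagerup

theorem mainTheorem3_general (𝕜 : Type v) [RCLike 𝕜] (G : Type u) [Group G] [TopologicalSpace G]
    [IsTopologicalGroup G] [FirstCountableTopology G] (hG : IsAmenableGroup G) :
    CoarselyEmbedsIntoHilbert 𝕜 G ↔ HasHaagerupProperty 𝕜 G := by
  constructor
  · rintro ⟨H, _, _, _, σ, hσ⟩
    let _ : InnerProductSpace ℝ H := InnerProductSpace.rclikeToReal 𝕜 H
    obtain ⟨d, K, hd, hK, hinv, hKd, hproper⟩ := hσ.exists_invariant_isCondNegDef hG
    exact hK.hasHaagerupProperty 𝕜 hinv hd hKd hproper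
  · rintro ⟨H, _, _, _, α, -, hα⟩
    exact ⟨H, inferInstance, inferInstance, inferInstance, _, hα⟩

theorem mainTheorem3 (𝕜 : Type v) [RCLike 𝕜] (G : Type u) [Group G] [TopologicalSpace G]
    [IsTopologicalGroup G] [PolishSpace G] (hG : IsAmenableGroup G) :
    CoarselyEmbedsIntoHilbert 𝕜 G ↔ HasHaagerupProperty 𝕜 G :=
  mainTheorem3_general 𝕜 G hG
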